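/- Let $m,n,m'\ge 0$ be integers, let $g\in\mathbb{R}^3$, and let $O_g(3)=\{O\in\mathbb{R}^{3\times 3} : O^\top O=I,\ Og=g\}$. A function $f:\mathbb{R}^{3\times m}\times\mathbb{R}^n\to\mathbb{R}^{3\times m'}$ is called $O_g(3)$-equivariant if $f(OZ,h)=O\,f(Z,h)$ for all $O\in O_g(3)$, $Z\in\mathbb{R}^{3\times m}$ and $h\in\mathbb{R}^n$. Let $[Z,g]\in\mathbb{R}^{3\times(m+1)}$ denote $Z$ with the additional column $g$, and for a map $\sigma:\mathbb{R}^{(m+1)\times(m+1)}\times\mathbb{R}^n\to\mathbb{R}^{(m+1)\times m'}$ put $$f_g(Z,h)=[Z,g]\,\sigma\big([Z,g]^\top[Z,g],\,h\big).$$ (a) For every $\sigma$, in particular for every multi-layer perceptron (MLP) $\sigma$, the function $f_g$ is $O_g(3)$-equivariant. (b) Fix a continuous activation function $\rho:\mathbb{R}\to\mathbb{R}$ that is not a polynomial. Let $\hat f:\mathbb{R}^{3\times m}\times\mathbb{R}^n\to\mathbb{R}^{3\times m'}$ be $O_g(3)$-equivariant, and let $K\subset\mathbb{R}^{3\times m}\times\mathbb{R}^n$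 be a compact set on which $\hat f$ is continuous. Then for every $\epsilon>0$ there is an MLP $\sigma$ with activation $\rho$ (finitely many, and at least one, hidden layers of finite widths, followed by an affine output layer; its inputs are the entries of the matrix argument together with those of $h$) such that $$\|\hat f(Z,h)-f_g(Z,h)\|_F<\epsilon\qquad\text{for all }(Z,h)\in K,$$ where $\|\cdot\|_F$ is the Frobenius norm. -/

import Mathlib

noncomputable section

/-- The group `O_g(3)` of orthogonal `3 × 3` matrices fixing the vector `g`. -/
def gravityGroup (g : Fin 3 → ℝ) : Subgroup (Matrix.orthogonalGroup (Fin 3) ℝ) where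
  carrier := {O | (O : Matrix (Fin 3) (Fin 3) ℝ).mulVec g = g}
  one_mem' := by simp
  mul_mem' := by
    intro A B hA hB
    simp only [Set.mem_ofPred_eq] at hA hB ⊢
    rw [Matrix.UnitaryGroup.mul_val, ← Matrix.mulVec_mulVec, hB, hA]
  inv_mem' := by
    intro A hA
    simp only [Set.mem_ofPred_eq] at hA ⊢
    have h : ((A⁻¹ * A : Matrix.orthogonalGroup (Fin 3) ℝ) : Matrix (Fin 3) (Fin 3) ℝ).mulVec g
        = g := by
      rw [inv_mul_cancel, Matrix.UnitaryGroup.one_val, Matrix.one_mulVec]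
    rwa [Matrix.UnitaryGroup.mul_val, ← Matrix.mulVec_mulVec, hA] at h

/-- A function `f : ℝ^{3×m} × ℝ^n → ℝ^{3×m'}` is `O_g(3)`-equivariant if
`f (O Z, h) = O f (Z, h)` for all `O ∈ O_g(3)`, `Z` and `h`. -/
def IsSubequivariant {m n m' : ℕ} (g : Fin 3 → ℝ)
    (f : Matrix (Fin 3) (Fin m) ℝ × (Fin n → ℝ) → Matrix (Fin 3) (Fin m') ℝ) : Prop :=
  ∀ O ∈ gravityGroup g, ∀ (Z : Matrix (Fin 3) (Fin m) ℝ) (h : Fin n → ℝ),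
    f ((O : Matrix (Fin 3) (Fin 3) ℝ) * Z, h) = (O : Matrix (Fin 3) (Fin 3) ℝ) * f (Z, h)

/-- The matrix `[Z, g]`: the columns of `Z`, followed by the column `g`.
Its `m + 1` columns are indexed by `Fin m ⊕ Unit`. -/
def augment {m : ℕ} (g : Fin 3 → ℝ) (Z : Matrix (Fin 3) (Fin m) ℝ) :
    Matrix (Fin 3) (Fin m ⊕ Unit) ℝ :=
  Matrix.fromCols Z (Matrix.replicateCol Unit g)

/-- The function `f_g (Z, h) = [Z, g] · σ([Z, g]ᵀ [Z, g], h)`. -/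
def subequivariantMap {m n m' : ℕ} (g : Fin 3 → ℝ)
    (σ : Matrix (Fin m ⊕ Unit) (Fin m ⊕ Unit) ℝ → (Fin n → ℝ) →
      Matrix (Fin m ⊕ Unit) (Fin m') ℝ)
    (p : Matrix (Fin 3) (Fin m) ℝ × (Fin n → ℝ)) : Matrix (Fin 3) (Fin m') ℝ :=
  augment g p.1 * σ ((augment g p.1).transpose * augment g p.1) p.2

/-- The parameters (weight matrices and bias vectors) of a multi-layer perceptron with inputs
indexed by `α` and outputs indexed by `β`: one or more hidden layers of arbitrary finite widths,
followed by an affine output layer. The layers are listed from the input side. -/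
inductive MLP (β : Type) : Type → Type 1
  /-- The last hidden layer (weights `W`, biases `b`) and the affine output layer (`U`, `c`). -/
  | last {α : Type} {k : ℕ} (W : Matrix (Fin k) α ℝ) (b : Fin k → ℝ)
      (U : Matrix β (Fin k) ℝ) (c : β → ℝ) : MLP β α
  /-- A hidden layer (weights `W`, biases `b`) that feeds the perceptron `N`. -/
  | layer {α : Type} {k : ℕ} (W : Matrix (Fin k) α ℝ) (b : Fin k → ℝ)
      (N : MLP β (Fin k)) : MLP β α

/-- The function computed by a multi-layer perceptron whose hidden units have activation `ρ`. -/
def MLP.eval (ρ : ℝ → ℝ) {β : Type} : {α : Type} → [Fintype α] → MLP β α → (α → ℝ) → (β → ℝ)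
  | _, _, .last W b U c, x => U.mulVec (fun i => ρ (W.mulVec x i + b i)) + c
  | _, _, .layer W b N, x => N.eval ρ (fun i => ρ (W.mulVec x i + b i))

/-- A perceptron read as a map `(G, h) ↦ V`: the entries of the matrix `G`, concatenated with
the vector `h`, are its inputs, and the entries of the matrix `V` are its outputs. -/
def MLP.matrixMap (ρ : ℝ → ℝ) {κ : Type} [Fintype κ] {n m' : ℕ}
    (N : MLP (κ × Fin m') ((κ × κ) ⊕ Fin n)) (G : Matrix κ κ ℝ) (h : Fin n → ℝ) :
    Matrix κ (Fin m') ℝ :=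
  Matrix.of fun i j => N.eval ρ (Sum.elim (fun q => G q.1 q.2) h) (i, j)

section

attribute [local instance] Matrix.frobeniusNormedAddCommGroup

/-- The Frobenius norm of a matrix. -/
def frobeniusNorm {k l : ℕ} (A : Matrix (Fin k) (Fin l) ℝ) : ℝ := ‖A‖

end

end

/-! Part (a) holds because the Gram matrix of `[Z, g]` is unchanged when an orthogonal matrix acts
on the left.

For (b), an orthogonal matrix fixing `[Z, g]` lies in `O_g(3)` and fixes `Z`, hence fixes `f (Z,
h)`; reflection in the column span then gives `f (Z, h) = [Z, g] * S`. Equal Gram matrices differ by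
an orthogonal matrix, which must fix `g`, so one `S` serves a whole fibre of the invariants. No
continuous choice of exact `S` is needed: the coefficients with error below `ε` form convex sets,
and by compactness of `K` an exact `S` stays admissible on nearby fibres, so a partition of unity
yields a continuous `σ`.

A perceptron then approximates `σ`. The closed span of hidden units contains all powers of linear
forms, since `ρ` is not a polynomial, hence their exponentials, and Stone–Weierstrass applies. -/

open MeasureTheory Topology
open scoped ContDiff

/-! ### Polynomials of bounded degree -/

/-- Real functions on `ℝ` given by polynomials of degree less than `k`. -/
noncomputable def polynomialFunctionsLT (k : ℕ) : Submodule ℝ (ℝ → ℝ) :=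
  (Polynomial.degreeLT ℝ k).map
    ({ toFun := fun P t => P.eval t
       map_add' := fun P Q => by ext t; simp
       map_smul' := fun a P => by ext t; simp } : Polynomial ℝ →ₗ[ℝ] (ℝ → ℝ))

theorem mem_polynomialFunctionsLT {k : ℕ} {f : ℝ → ℝ} :
    f ∈ polynomialFunctionsLT k ↔
      ∃ P ∈ Polynomial.degreeLT ℝ k, (fun t => Polynomial.eval t P) = f := by
  simp [polynomialFunctionsLT]

/-- Finite-dimensional subspaces are closed. The topology is that of pointwise convergence, so
pointwise limits keep the degree bound. -/
theorem isClosed_polynomialFunctionsLT (k : ℕ) :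
    IsClosed (polynomialFunctionsLT k : Set (ℝ → ℝ)) := by
  have : FiniteDimensional ℝ (Polynomial.degreeLT ℝ k) :=
    Module.Finite.equiv (Polynomial.degreeLTEquiv ℝ k).symm
  have : FiniteDimensional ℝ (polynomialFunctionsLT k) := by
    unfold polynomialFunctionsLT
    infer_instance
  exact Submodule.closed_of_finiteDimensional _

/-- The Lagrange remainder vanishes, so `f` is its Taylor polynomial at `0`. -/
theorem exists_polynomial_of_iteratedDeriv_eq_zero (k : ℕ) (f : ℝ → ℝ) (hf : ContDiff ℝ k f)
    (h : ∀ x, iteratedDeriv k f x = 0) : f ∈ polynomialFunctionsLT k := by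
  rcases k with _ | k
  · have : f = 0 := by ext x; simpa using h x
    rw [this]
    exact Submodule.zero_mem _
  · rw [mem_polynomialFunctionsLT]
    refine ⟨∑ i ∈ Finset.range (k + 1),
      Polynomial.monomial i (iteratedDeriv i f 0 / (i.factorial : ℝ)), ?_, ?_⟩
    · refine Submodule.sum_mem _ fun i hi => ?_
      rw [Polynomial.mem_degreeLT]
      refine (Polynomial.degree_monomial_le _ _).trans_lt ?_
      exact_mod_cast Finset.mem_range.1 hi
    · ext x
      rcases eq_or_ne x 0 with rfl | hx
      · rw [Polynomial.eval_finsetSum, Finset.sum_eq_single 0]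
        · simp
        · intro i _ hi
          simp [hi]
        · simp
      · have hu : UniqueDiffOn ℝ (Set.uIcc 0 x) := uniqueDiffOn_uIcc hx.symm
        have key : ∀ i ≤ k + 1, ∀ y ∈ Set.uIcc 0 x,
            iteratedDerivWithin i f (Set.uIcc 0 x) y = iteratedDeriv i f y := fun i hi y hy =>
          iteratedDerivWithin_eq_iteratedDeriv hu
            ((hf.of_le (by exact_mod_cast hi)).contDiffAt) hy
        obtain ⟨y, hy, he⟩ := taylor_mean_remainder_lagrange (f := f) (n := k) hx.symm
          ((hf.of_le (by exact_mod_cast Nat.le_succ k)).contDiffOn)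
          (((hf.contDiffOn (s := Set.uIcc 0 x)).differentiableOn_iteratedDerivWithin
            (by exact_mod_cast Nat.lt_succ_self k) hu).mono Set.uIoo_subset_uIcc_self)
        rw [key _ le_rfl _ (Set.uIoo_subset_uIcc_self hy), h y, zero_mul, zero_div,
          sub_eq_zero] at he
        rw [he, taylor_within_apply, Polynomial.eval_finsetSum]
        refine Finset.sum_congr rfl fun i hi => ?_
        rw [key i (Finset.mem_range.1 hi).le _ Set.left_mem_uIcc]
        simp
        ring

/-! ### Ridge functions in a closed subspace -/

section

variable {X : Type*} [TopologicalSpace X]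

/-- The function `x ↦ f (s * u x + b)`. -/
def affineComp (u : C(X, ℝ)) (f : C(ℝ, ℝ)) (s b : ℝ) : C(X, ℝ) :=
  f.comp (s • u + ContinuousMap.const X b)

@[simp] theorem affineComp_apply (u : C(X, ℝ)) (f : C(ℝ, ℝ)) (s b : ℝ) (x : X) :
    affineComp u f s b x = f (s * u x + b) := rfl

theorem continuous_affineComp (u : C(X, ℝ)) (f : C(ℝ, ℝ)) :
    Continuous fun q : ℝ × ℝ => affineComp u f q.1 q.2 := by
  refine ContinuousMap.continuous_of_continuous_uncurry _ ?_
  change Continuous fun q : (ℝ × ℝ) × X => f (q.1.1 * u q.2 + q.1.2)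
  fun_prop

/-- A closed subspace containing a differentiable curve contains its derivatives. -/
theorem Submodule.mem_of_hasDerivAt {E : Type*} [NormedAddCommGroup E] [NormedSpace ℝ E]
    {V : Submodule ℝ E} (hV : IsClosed (V : Set E)) {c : ℝ → E} (hc : ∀ s, c s ∈ V) {c' : E}
    {s : ℝ} (h : HasDerivAt c c' s) : c' ∈ V := by
  have := h.tendsto_slope
  refine hV.mem_of_tendsto this (Filter.Eventually.of_forall fun t => ?_)
  simp only [slope, vsub_eq_sub]
  exact V.smul_mem _ (V.sub_mem (hc _) (hc _))

theorem Submodule.integral_mem_of_isClosed {E : Type*} [NormedAddCommGroup E] [NormedSpace ℝ E]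
    [CompleteSpace E] {V : Submodule ℝ E} (hV : IsClosed (V : Set E)) {c : ℝ → E}
    (hc : ∀ s, c s ∈ V) (hcont : Continuous c) (hsupp : HasCompactSupport c) :
    ∫ s, c s ∈ V := by
  have : CompleteSpace V := hV.completeSpace_coe
  let d : ℝ → V := fun s => ⟨c s, hc s⟩
  have hd : Continuous d := hcont.subtype_mk _
  have hds : HasCompactSupport d := by
    have : Function.support d = Function.support c := by
      ext s
      simp [d, Subtype.ext_iff]
    unfold HasCompactSupport tsupport
    rw [this]
    exact hsupp
  have := V.subtypeL.integral_comp_comm (hd.integrable_of_hasCompactSupport hds (μ := volume))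
  have h2 : ∫ s, c s = V.subtypeL (∫ s, d s) := this
  rw [h2]
  exact (∫ s, d s).2

variable [CompactSpace X]

/-- Differentiability is needed in the sup norm. The curve is a constant plus the integral of a
continuous `C(X, ℝ)`-valued function, an identity checked pointwise. -/
theorem hasDerivAt_affineComp (u : C(X, ℝ)) (f f' : C(ℝ, ℝ)) (hf : ∀ t, HasDerivAt f (f' t) t)
    (g : C(X, ℝ)) (s b : ℝ) :
    HasDerivAt (fun s => g * affineComp u f s b) (g * u * affineComp u f' s b) s := by
  have hcont : Continuous fun σ => g * u * affineComp u f' σ b :=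
    continuous_const.mul ((continuous_affineComp u f').comp
      (by fun_prop : Continuous fun σ => (σ, b)))
  have h := ((hcont.integral_hasStrictDerivAt 0 s).hasDerivAt).const_add (g * affineComp u f 0 b)
  refine h.congr_of_eventuallyEq (Filter.Eventually.of_forall fun σ => ?_)
  ext x
  have h1 := (ContinuousMap.evalCLM ℝ x).intervalIntegral_comp_comm
    (hcont.intervalIntegrable (μ := volume) 0 σ)
  have h2 : ∫ y in (0:ℝ)..σ, (ContinuousMap.evalCLM ℝ x) (g * u * affineComp u f' y b)
      = g x * f (σ * u x + b) - g x * f (0 * u x + b) := by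
    refine intervalIntegral.integral_eq_sub_of_hasDerivAt (f := fun τ => g x * f (τ * u x + b)) ?_ ?_
    · intro τ _
      have h3 : HasDerivAt (fun τ => τ * u x + b) (u x) τ := by
        simpa using ((hasDerivAt_id τ).mul_const (u x)).add_const b
      have h4 := ((hf (τ * u x + b)).comp τ h3).const_mul (g x)
      refine h4.congr_deriv ?_
      change _ = g x * u x * f' (τ * u x + b)
      ring
    · exact (((ContinuousMap.evalCLM ℝ x).continuous.comp hcont).intervalIntegrable 0 σ)
  have h5 : (∫ y in (0:ℝ)..σ, g * u * affineComp u f' y b) x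
      = g x * f (σ * u x + b) - g x * f (0 * u x + b) := by
    rw [← h2, h1]; rfl
  change g x * f (σ * u x + b) = g x * f (0 * u x + b) +
    (∫ y in (0 : ℝ)..σ, g * u * affineComp u f' y b) x
  rw [h5]
  ring

/-- If a closed subspace contains all `x ↦ f (s * u x + b)`, with `f` smooth, then it contains
all `x ↦ u x ^ k * f⁽ᵏ⁾ (s * u x + b)`. -/
theorem pow_mul_affineComp_iteratedDeriv_mem {V : Submodule ℝ C(X, ℝ)}
    (hV : IsClosed (V : Set C(X, ℝ))) (u : C(X, ℝ)) (f : ℝ → ℝ) (hf : ContDiff ℝ ∞ f)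
    (h : ∀ s b, affineComp u ⟨f, hf.continuous⟩ s b ∈ V) (k : ℕ) (s b : ℝ) :
    u ^ k * affineComp u ⟨iteratedDeriv k f, hf.continuous_iteratedDeriv k (by exact_mod_cast le_top)⟩ s b ∈ V := by
  induction k generalizing s b with
  | zero => simpa using h s b
  | succ k ih =>
    have := Submodule.mem_of_hasDerivAt hV (fun s => ih s b)
      (hasDerivAt_affineComp u ⟨iteratedDeriv k f, hf.continuous_iteratedDeriv k (by exact_mod_cast le_top)⟩
        ⟨iteratedDeriv (k + 1) f, hf.continuous_iteratedDeriv (k + 1) (by exact_mod_cast le_top)⟩ (fun t => by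
          simp only [ContinuousMap.coe_mk]
          rw [iteratedDeriv_succ]
          exact ((hf.differentiable_iteratedDeriv k
            (by exact_mod_cast WithTop.coe_lt_top k)) t).hasDerivAt) (u ^ k) s b)
    rwa [← pow_succ] at this

/-- Convolving averages translates of `ρ`, which only shift `b`; this makes smooth activations
available. -/
theorem affineComp_convolution_mem {V : Submodule ℝ C(X, ℝ)}
    (hV : IsClosed (V : Set C(X, ℝ))) (u : C(X, ℝ)) (ρ : C(ℝ, ℝ))
    (h : ∀ s b, affineComp u ρ s b ∈ V) (φ : ℝ → ℝ) (hφ : Continuous φ)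
    (hs : HasCompactSupport φ) (f : C(ℝ, ℝ))
    (hf : ∀ t, f t = convolution φ ρ (ContinuousLinearMap.lsmul ℝ ℝ) volume t) (s b : ℝ) :
    affineComp u f s b ∈ V := by
  have hcont : Continuous fun τ => φ τ • affineComp u ρ s (b - τ) :=
    hφ.smul ((continuous_affineComp u ρ).comp (by fun_prop : Continuous fun τ => (s, b - τ)))
  have hsupp : HasCompactSupport fun τ => φ τ • affineComp u ρ s (b - τ) := hs.smul_right
  have key : affineComp u f s b = ∫ τ, φ τ • affineComp u ρ s (b - τ) := by
    ext x
    have h1 := (ContinuousMap.evalCLM ℝ x).integral_comp_comm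
      (hcont.integrable_of_hasCompactSupport hsupp (μ := volume))
    change _ = (ContinuousMap.evalCLM ℝ x) (∫ τ, φ τ • affineComp u ρ s (b - τ))
    rw [← h1, affineComp_apply, hf, convolution_def]
    refine integral_congr_ae (Filter.Eventually.of_forall fun τ => ?_)
    simp [ContinuousMap.evalCLM, add_sub_assoc]
  rw [key]
  exact Submodule.integral_mem_of_isClosed hV (fun τ => V.smul_mem _ (h _ _)) hcont hsupp

/-- A closed subspace of `C(X, ℝ)` that contains all `x ↦ ρ (s * u x + b)`, where `ρ` is continuous
and not a polynomial, contains all powers of `u`. -/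
theorem pow_mem_of_affineComp_mem {V : Submodule ℝ C(X, ℝ)}
    (hV : IsClosed (V : Set C(X, ℝ))) (u : C(X, ℝ)) (ρ : C(ℝ, ℝ))
    (hρ : ¬ ∃ P : Polynomial ℝ, ∀ t : ℝ, ρ t = P.eval t)
    (h : ∀ s b, affineComp u ρ s b ∈ V) (k : ℕ) : u ^ k ∈ V := by
  by_contra hk
  have hpoly : ∀ φ : ContDiffBump (0 : ℝ),
      convolution (φ.normed volume) ρ (ContinuousLinearMap.lsmul ℝ ℝ) volume
        ∈ polynomialFunctionsLT k := by
    intro φ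
    set f := convolution (φ.normed volume) ρ (ContinuousLinearMap.lsmul ℝ ℝ) volume with hfdef
    have hfs : ContDiff ℝ ∞ f :=
      φ.hasCompactSupport_normed.contDiff_convolution_left _ φ.contDiff_normed
        ρ.continuous.locallyIntegrable
    refine exists_polynomial_of_iteratedDeriv_eq_zero k f
      (hfs.of_le (by exact_mod_cast le_top)) fun b => ?_
    by_contra hb
    -- At `s = 0` the ridge factor is the nonzero constant `iteratedDeriv k f b`, which can be
    -- divided out.
    have hmem := pow_mul_affineComp_iteratedDeriv_mem hV u f hfs
      (affineComp_convolution_mem hV u ρ h (φ.normed volume) φ.continuous_normed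
        φ.hasCompactSupport_normed ⟨f, hfs.continuous⟩ (fun _ => rfl)) k 0 b
    refine hk ?_
    convert V.smul_mem (iteratedDeriv k f b)⁻¹ hmem using 1
    ext x
    simp
    field_simp
  let φ : ℕ → ContDiffBump (0 : ℝ) := fun n =>
    ⟨1 / ((n : ℝ) + 1), 2 / ((n : ℝ) + 1), by positivity, by gcongr; norm_num⟩
  have hφ : Filter.Tendsto (fun n => (φ n).rOut) Filter.atTop (𝓝 0) := by
    have := (tendsto_one_div_add_atTop_nhds_zero_nat (𝕜 := ℝ)).const_mul 2
    simpa only [φ, mul_one_div, mul_zero] using this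
  -- The mollifications converge to `ρ`, and the degree bound `k` is the same for all of them.
  have hlim := (isClosed_polynomialFunctionsLT k).mem_of_tendsto
    (tendsto_pi_nhds.2 fun t =>
      ContDiffBump.convolution_tendsto_right_of_continuous (μ := volume) hφ ρ.continuous t)
    (Filter.Eventually.of_forall fun n => hpoly (φ n))
  obtain ⟨P, -, hP⟩ := mem_polynomialFunctionsLT.1 hlim
  exact hρ ⟨P, fun t => (congrFun hP t).symm⟩

end

/-! ### Universal approximation by one hidden layer -/

section

variable {α : Type*} [Fintype α] {X : Type*} [TopologicalSpace X]

/-- The linear functional `x ↦ w ⬝ᵥ e x`, as a continuous function. -/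
def dotProductMap (e : C(X, α → ℝ)) (w : α → ℝ) : C(X, ℝ) :=
  ⟨fun x => w ⬝ᵥ e x, by simp only [dotProduct]; fun_prop⟩

@[simp] theorem dotProductMap_apply (e : C(X, α → ℝ)) (w : α → ℝ) (x : X) :
    dotProductMap e w x = w ⬝ᵥ e x := rfl

/-- The function `x ↦ ρ (w ⬝ᵥ e x + b)` of a single hidden unit. -/
def hiddenUnit (ρ : C(ℝ, ℝ)) (e : C(X, α → ℝ)) (q : (α → ℝ) × ℝ) : C(X, ℝ) :=
  affineComp (dotProductMap e q.1) ρ 1 q.2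

@[simp] theorem hiddenUnit_apply (ρ : C(ℝ, ℝ)) (e : C(X, α → ℝ)) (q : (α → ℝ) × ℝ) (x : X) :
    hiddenUnit ρ e q x = ρ (q.1 ⬝ᵥ e x + q.2) := by simp [hiddenUnit]

variable [CompactSpace X]

theorem NormedSpace.exp_mem_of_pow_mem {V : Submodule ℝ C(X, ℝ)} (hV : IsClosed (V : Set C(X, ℝ)))
    (u : C(X, ℝ)) (h : ∀ k, u ^ k ∈ V) : NormedSpace.exp u ∈ V :=
  hV.mem_of_tendsto (NormedSpace.exp_series_hasSum_exp' (𝕂 := ℝ) u)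
    (Filter.Eventually.of_forall fun _ => V.sum_mem fun k _ => V.smul_mem _ (h k))

theorem exists_exp_dotProductMap_ne (e : C(X, α → ℝ)) (he : Function.Injective e) {x y : X}
    (hxy : x ≠ y) : ∃ w, NormedSpace.exp (dotProductMap e w) x ≠
      NormedSpace.exp (dotProductMap e w) y := by
  classical
  have happ : ∀ (u : C(X, ℝ)) (x : X), NormedSpace.exp u x = Real.exp (u x) := fun u x => by
    rw [Real.exp_eq_exp_ℝ]
    exact NormedSpace.map_exp (ContinuousMap.evalAlgHom ℝ ℝ x) (ContinuousMap.evalCLM ℝ x).continuous u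
  obtain ⟨i, hi⟩ := Function.ne_iff.1 (he.ne hxy)
  refine ⟨Pi.single i 1, ?_⟩
  rw [happ, happ]
  simpa using hi

/-- Functions computed by one hidden layer with a continuous nonpolynomial activation are dense. -/
theorem dense_span_hiddenUnit (ρ : C(ℝ, ℝ))
    (hρ : ¬ ∃ P : Polynomial ℝ, ∀ t : ℝ, ρ t = P.eval t) (e : C(X, α → ℝ))
    (he : Function.Injective e) :
    (Submodule.span ℝ (Set.range (hiddenUnit ρ e))).topologicalClosure = ⊤ := by
  set V := (Submodule.span ℝ (Set.range (hiddenUnit ρ e))).topologicalClosure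
  have hV : IsClosed (V : Set C(X, ℝ)) := Submodule.isClosed_topologicalClosure _
  have hpow : ∀ w k, dotProductMap e w ^ k ∈ V := fun w k =>
    pow_mem_of_affineComp_mem hV _ ρ hρ (fun s b => by
      refine Submodule.le_topologicalClosure _ (Submodule.subset_span ⟨(s • w, b), ?_⟩)
      ext x
      simp) k
  have hexp : ∀ w, NormedSpace.exp (dotProductMap e w) ∈ V := fun w =>
    NormedSpace.exp_mem_of_pow_mem hV _ (hpow w)
  -- Exponentials of linear forms are closed under products, so their span is already an algebra.
  let M : Submonoid C(X, ℝ) :=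
    { carrier := Set.range fun w => NormedSpace.exp (dotProductMap e w)
      one_mem' := ⟨0, by
        have : dotProductMap e 0 = 0 := by ext x; simp
        simp [this]⟩
      mul_mem' := by
        rintro _ _ ⟨v, rfl⟩ ⟨w, rfl⟩
        refine ⟨v + w, ?_⟩
        have : dotProductMap e (v + w) = dotProductMap e v + dotProductMap e w := by
          ext x; simp [add_dotProduct]
        simp only [this]
        exact NormedSpace.exp_add }
  have hA : (Algebra.adjoin ℝ (M : Set C(X, ℝ))).topologicalClosure = ⊤ := by
    refine ContinuousMap.subalgebra_topologicalClosure_eq_top_of_separatesPoints _ ?_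
    intro x y hxy
    obtain ⟨w, hw⟩ := exists_exp_dotProductMap_ne e he hxy
    exact ⟨_, ⟨_, Algebra.subset_adjoin ⟨w, rfl⟩, rfl⟩, hw⟩
  rw [eq_top_iff]
  intro f _
  have hf : f ∈ (Algebra.adjoin ℝ (M : Set C(X, ℝ))).topologicalClosure := by
    rw [hA]; trivial
  refine closure_minimal ?_ hV hf
  intro g hg
  have hg' : g ∈ Subalgebra.toSubmodule (Algebra.adjoin ℝ (M : Set C(X, ℝ))) := hg
  rw [Algebra.adjoin_eq_span_of_subset] at hg'
  · refine Submodule.span_le.2 ?_ hg'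
    rintro _ ⟨w, rfl⟩
    exact hexp w
  · rw [Submonoid.closure_eq]
    exact Submodule.subset_span

end

/-- Finitely many linear combinations of hidden units are computed by one perceptron. -/
theorem MLP.exists_eval_eq {α β : Type} [Fintype α] [Fintype β] (ρ : ℝ → ℝ)
    (c : β → ((α → ℝ) × ℝ) →₀ ℝ) :
    ∃ N : MLP β α, ∀ x i, N.eval ρ x i = (c i).sum fun q a => a * ρ (q.1 ⬝ᵥ x + q.2) := by
  classical
  let T : Finset ((α → ℝ) × ℝ) := Finset.univ.biUnion fun i => (c i).support
  let τ : T ≃ Fin T.card := T.equivFin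
  refine ⟨.last (Matrix.of fun j => (τ.symm j).1.1) (fun j => (τ.symm j).1.2)
    (Matrix.of fun i j => c i (τ.symm j).1) 0, fun x i => ?_⟩
  have hsub : (c i).support ⊆ T := Finset.subset_biUnion_of_mem (fun i => (c i).support)
    (Finset.mem_univ i)
  rw [Finsupp.sum_of_support_subset _ hsub _ (by simp), ← Finset.sum_coe_sort,
    ← τ.symm.sum_comp]
  simp [MLP.eval, Matrix.mulVec, dotProduct]

/-- Universal approximation: on a compact set, perceptrons with a continuous nonpolynomial
activation approximate every continuous vector-valued function uniformly. -/
theorem MLP.exists_forall_abs_sub_lt {α β : Type} [Fintype α] [Fintype β] (ρ : ℝ → ℝ)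
    (hc : Continuous ρ) (hρ : ¬ ∃ P : Polynomial ℝ, ∀ t : ℝ, ρ t = P.eval t)
    {Y : Set (α → ℝ)} (hY : IsCompact Y) (σ : C(Y, β → ℝ)) {δ : ℝ} (hδ : 0 < δ) :
    ∃ N : MLP β α, ∀ y : Y, ∀ i, |σ y i - N.eval ρ y i| < δ := by
  have : CompactSpace Y := isCompact_iff_compactSpace.1 hY
  let e : C(Y, α → ℝ) := ⟨Subtype.val, continuous_subtype_val⟩
  have key : ∀ i, ∃ c : ((α → ℝ) × ℝ) →₀ ℝ, ∀ y : Y,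
      |σ y i - c.sum fun q a => a * ρ (q.1 ⬝ᵥ (y : α → ℝ) + q.2)| < δ := by
    intro i
    let σi : C(Y, ℝ) := ⟨fun y => σ y i, by fun_prop⟩
    have hmem : σi ∈ (Submodule.span ℝ (Set.range (hiddenUnit ⟨ρ, hc⟩ e))).topologicalClosure := by
      rw [dense_span_hiddenUnit ⟨ρ, hc⟩ hρ e Subtype.val_injective]
      trivial
    obtain ⟨g, hg, hgd⟩ := Metric.mem_closure_iff.1 hmem δ hδ
    obtain ⟨c, rfl⟩ := Finsupp.mem_span_range_iff_exists_finsupp.1 hg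
    refine ⟨c, fun y => ?_⟩
    have := (ContinuousMap.dist_lt_iff hδ).1 hgd y
    simpa [Real.dist_eq, σi, e, Finsupp.sum, ContinuousMap.sum_apply] using this
  choose c hcσ using key
  obtain ⟨N, hN⟩ := MLP.exists_eval_eq ρ c
  exact ⟨N, fun y i => by rw [hN]; exact hcσ i y⟩

/-! ### Orthogonal matrices, Gram matrices and equivariance -/

/-- Every linear isometry of Euclidean space is given by an orthogonal matrix. -/
theorem LinearIsometry.exists_orthogonalGroup {n : Type*} [Fintype n] [DecidableEq n]
    (L : EuclideanSpace ℝ n →ₗᵢ[ℝ] EuclideanSpace ℝ n) :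
    ∃ O : Matrix.orthogonalGroup n ℝ, ∀ x : n → ℝ,
      (O : Matrix n n ℝ).mulVec x = (L (WithLp.toLp 2 x)).ofLp := by
  let e := L.toLinearIsometryEquiv rfl
  let b := EuclideanSpace.basisFun n ℝ
  refine ⟨⟨_, e.toMatrix_mem_unitaryGroup b b⟩, fun x => ?_⟩
  have := LinearMap.toMatrix_mulVec_repr b.toBasis b.toBasis e.toLinearMap (WithLp.toLp 2 x)
  exact this

/-- Matrices with the same Gram matrix differ by an orthogonal matrix. -/
theorem Matrix.exists_orthogonalGroup_mul_eq {n k : Type*} [Fintype n] [DecidableEq n] [Fintype k]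
    [DecidableEq k] {A B : Matrix n k ℝ} (h : A.transpose * A = B.transpose * B) :
    ∃ O : Matrix.orthogonalGroup n ℝ, (O : Matrix n n ℝ) * A = B := by
  let E := EuclideanSpace ℝ n
  let toE : (n → ℝ) ≃ₗ[ℝ] E := (WithLp.linearEquiv 2 ℝ (n → ℝ)).symm
  let a : (k → ℝ) →ₗ[ℝ] E := toE.toLinearMap ∘ₗ A.mulVecLin
  let b : (k → ℝ) →ₗ[ℝ] E := toE.toLinearMap ∘ₗ B.mulVecLin
  have hsq : ∀ (C : Matrix n k ℝ) (x : k → ℝ),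
      ‖toE (C.mulVec x)‖ ^ 2 = x ⬝ᵥ (C.transpose * C).mulVec x := by
    intro C x
    rw [EuclideanSpace.real_norm_sq_eq, ← Matrix.mulVec_mulVec, Matrix.dotProduct_mulVec,
      Matrix.vecMul_transpose]
    simp only [dotProduct, sq]
    rfl
  have hn : ∀ x, ‖b x‖ = ‖a x‖ := fun x => by
    have : ‖b x‖ ^ 2 = ‖a x‖ ^ 2 := by
      change ‖toE (B.mulVec x)‖ ^ 2 = ‖toE (A.mulVec x)‖ ^ 2
      rw [hsq, hsq, h]
    exact (sq_eq_sq₀ (norm_nonneg _) (norm_nonneg _)).1 this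
  -- Equal norms make `A x ↦ B x` a well-defined isometry on the range of `A`; a linear section `r`
  -- expresses it.
  obtain ⟨r, hr⟩ := a.rangeRestrict.exists_rightInverse_of_surjective a.range_rangeRestrict
  have har : ∀ y, a (r y) = y := fun y => congrArg Subtype.val (LinearMap.congr_fun hr y)
  let L : LinearMap.range a →ₗᵢ[ℝ] E :=
    { toLinearMap := b ∘ₗ r
      norm_map' := fun y => by
        change ‖b (r y)‖ = ‖y‖
        rw [hn, har]; rfl }
  have hL : ∀ x, L.extend (a x) = b x := fun x => by
    have h1 : L.extend (a x) = b (r ⟨a x, x, rfl⟩) := L.extend_apply ⟨a x, x, rfl⟩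
    rw [h1, ← sub_eq_zero, ← map_sub, ← norm_eq_zero, hn, map_sub, har, sub_self, norm_zero]
  obtain ⟨O, hO⟩ := L.extend.exists_orthogonalGroup
  refine ⟨O, ?_⟩
  refine Matrix.toLin'.injective (LinearMap.ext fun x => ?_)
  rw [Matrix.toLin'_apply, Matrix.toLin'_apply, ← Matrix.mulVec_mulVec, hO]
  exact congrArg WithLp.ofLp (hL x)

theorem augment_mul {m : ℕ} {g : Fin 3 → ℝ} {O : Matrix.orthogonalGroup (Fin 3) ℝ}
    (hO : O ∈ gravityGroup g) (Z : Matrix (Fin 3) (Fin m) ℝ) :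
    augment g ((O : Matrix (Fin 3) (Fin 3) ℝ) * Z)
      = (O : Matrix (Fin 3) (Fin 3) ℝ) * augment g Z := by
  have hg : (O : Matrix (Fin 3) (Fin 3) ℝ).mulVec g = g := hO
  have : (O : Matrix (Fin 3) (Fin 3) ℝ) * Matrix.replicateCol Unit g
      = Matrix.replicateCol Unit g := by
    rw [← Matrix.replicateCol_mulVec, hg]
  rw [augment, augment, Matrix.mul_fromCols, this]

/-- The appended column is what forces `O` to fix `g`. -/
theorem exists_gravityGroup_of_mul_augment_eq {m : ℕ} {g : Fin 3 → ℝ}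
    {Z Z' : Matrix (Fin 3) (Fin m) ℝ} {O : Matrix.orthogonalGroup (Fin 3) ℝ}
    (h : (O : Matrix (Fin 3) (Fin 3) ℝ) * augment g Z = augment g Z') :
    O ∈ gravityGroup g ∧ (O : Matrix (Fin 3) (Fin 3) ℝ) * Z = Z' := by
  rw [augment, augment, Matrix.mul_fromCols, Matrix.fromCols_ext_iff,
    ← Matrix.replicateCol_mulVec, Matrix.replicateCol_inj] at h
  exact ⟨h.2, h.1⟩

theorem Matrix.orthogonalGroup.transpose_mul_self {n : Type*} [Fintype n] [DecidableEq n]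
    (O : Matrix.orthogonalGroup n ℝ) : (O : Matrix n n ℝ).transpose * (O : Matrix n n ℝ) = 1 :=
  (Matrix.mem_orthogonalGroup_iff' n ℝ).1 O.2

theorem isSubequivariant_subequivariantMap {m n m' : ℕ} (g : Fin 3 → ℝ)
    (σ : Matrix (Fin m ⊕ Unit) (Fin m ⊕ Unit) ℝ → (Fin n → ℝ) →
      Matrix (Fin m ⊕ Unit) (Fin m') ℝ) : IsSubequivariant g (subequivariantMap g σ) := by
  intro O hO Z h
  have : ((O : Matrix (Fin 3) (Fin 3) ℝ) * augment g Z).transpose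
      * ((O : Matrix (Fin 3) (Fin 3) ℝ) * augment g Z)
      = (augment g Z).transpose * augment g Z := by
    rw [Matrix.transpose_mul, Matrix.mul_assoc, ← Matrix.mul_assoc _ (O : Matrix (Fin 3) (Fin 3) ℝ),
      Matrix.orthogonalGroup.transpose_mul_self, Matrix.one_mul]
  simp only [subequivariantMap, augment_mul hO, this, Matrix.mul_assoc]

/-- If every orthogonal matrix that fixes the columns of `A` fixes the columns of `F`, then the
columns of `F` are combinations of those of `A`. -/
theorem Matrix.exists_mul_eq_of_orthogonalGroup {n k l : Type*} [Fintype n] [DecidableEq n]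
    [Fintype k] [DecidableEq k] {A : Matrix n k ℝ} {F : Matrix n l ℝ}
    (h : ∀ O : Matrix.orthogonalGroup n ℝ, (O : Matrix n n ℝ) * A = A →
      (O : Matrix n n ℝ) * F = F) : ∃ S : Matrix k l ℝ, F = A * S := by
  let E := EuclideanSpace ℝ n
  let toE : (n → ℝ) ≃ₗ[ℝ] E := (WithLp.linearEquiv 2 ℝ (n → ℝ)).symm
  let a : (k → ℝ) →ₗ[ℝ] E := toE.toLinearMap ∘ₗ A.mulVecLin
  -- The fixed vectors of this reflection are exactly the column span of `A`.
  obtain ⟨O, hO⟩ := (LinearMap.range a).reflection.toLinearIsometry.exists_orthogonalGroup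
  have hA : (O : Matrix n n ℝ) * A = A := by
    refine Matrix.toLin'.injective (LinearMap.ext fun x => ?_)
    rw [Matrix.toLin'_apply, Matrix.toLin'_apply, ← Matrix.mulVec_mulVec, hO]
    exact congrArg WithLp.ofLp ((Submodule.reflection_eq_self_iff (a x)).2 (LinearMap.mem_range_self a x))
  have hF := h O hA
  have hcol : ∀ j, ∃ s : k → ℝ, A.mulVec s = F.col j := by
    intro j
    have h1 : (O : Matrix n n ℝ).mulVec (F.col j) = F.col j := by
      ext i
      exact congrFun (congrFun hF i) j
    rw [hO] at h1
    obtain ⟨s, hs⟩ := (Submodule.reflection_eq_self_iff (toE (F.col j))).1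
      (congrArg (WithLp.toLp 2) h1)
    exact ⟨s, congrArg WithLp.ofLp hs⟩
  choose s hs using hcol
  refine ⟨Matrix.of fun i j => s j i, ?_⟩
  ext i j
  exact (congrFun (hs j) i).symm

/-! ### Frobenius norm and continuity of the invariants -/

section

attribute [local instance] Matrix.frobeniusNormedAddCommGroup Matrix.frobeniusNormedSpace

theorem frobeniusNorm_add_le {k l : ℕ} (A B : Matrix (Fin k) (Fin l) ℝ) :
    frobeniusNorm (A + B) ≤ frobeniusNorm A + frobeniusNorm B := norm_add_le A B

theorem frobeniusNorm_smul {k l : ℕ} (a : ℝ) (A : Matrix (Fin k) (Fin l) ℝ) :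
    frobeniusNorm (a • A) = |a| * frobeniusNorm A := norm_smul a A

theorem frobeniusNorm_zero {k l : ℕ} : frobeniusNorm (0 : Matrix (Fin k) (Fin l) ℝ) = 0 :=
  norm_zero

theorem frobeniusNorm_eq {k l : ℕ} (A : Matrix (Fin k) (Fin l) ℝ) :
    frobeniusNorm A = (∑ i, ∑ j, ‖A i j‖ ^ 2) ^ (1 / 2 : ℝ) := by
  rw [frobeniusNorm, Matrix.frobenius_norm_def]
  simp

end

theorem continuous_frobeniusNorm {k l : ℕ} :
    Continuous (frobeniusNorm : Matrix (Fin k) (Fin l) ℝ → ℝ) := by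
  simp only [funext frobeniusNorm_eq]
  refine Continuous.rpow_const ?_ fun _ => Or.inr (by norm_num)
  fun_prop

theorem convex_frobeniusNorm_sub_mul_lt {k l : ℕ} {κ : Type*} [Fintype κ]
    (F : Matrix (Fin k) (Fin l) ℝ) (A : Matrix (Fin k) κ ℝ) (ε : ℝ) :
    Convex ℝ {S : Matrix κ (Fin l) ℝ | frobeniusNorm (F - A * S) < ε} := by
  intro S hS T hT a b ha hb hab
  have h : F - A * (a • S + b • T) = a • (F - A * S) + b • (F - A * T) := by
    rw [Matrix.mul_add, Matrix.mul_smul, Matrix.mul_smul, smul_sub, smul_sub]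
    nth_rw 1 [← one_smul ℝ F, ← hab, add_smul]
    abel
  have h1 : frobeniusNorm (F - A * (a • S + b • T))
      ≤ a * frobeniusNorm (F - A * S) + b * frobeniusNorm (F - A * T) := by
    rw [h]
    refine (frobeniusNorm_add_le _ _).trans_eq ?_
    rw [frobeniusNorm_smul, frobeniusNorm_smul, abs_of_nonneg ha, abs_of_nonneg hb]
  exact h1.trans_lt ((convex_Iio ε) hS hT ha hb hab)

theorem continuous_augment {m : ℕ} (g : Fin 3 → ℝ) :
    Continuous (augment g : Matrix (Fin 3) (Fin m) ℝ → _) := by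
  refine continuous_matrix fun i j => ?_
  rcases j with j | j
  · exact continuous_id.matrix_elem i j
  · exact continuous_const

/-- The entries of the Gram matrix of `[Z, g]`, concatenated with `h`. -/
def gramInput {m n : ℕ} (g : Fin 3 → ℝ) (p : Matrix (Fin 3) (Fin m) ℝ × (Fin n → ℝ)) :
    ((Fin m ⊕ Unit) × (Fin m ⊕ Unit)) ⊕ Fin n → ℝ :=
  Sum.elim (fun q => ((augment g p.1).transpose * augment g p.1) q.1 q.2) p.2

theorem continuous_gramInput {m n : ℕ} (g : Fin 3 → ℝ) :
    Continuous (gramInput g : Matrix (Fin 3) (Fin m) ℝ × (Fin n → ℝ) → _) := by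
  have hA : Continuous fun p : Matrix (Fin 3) (Fin m) ℝ × (Fin n → ℝ) => augment g p.1 :=
    (continuous_augment g).comp continuous_fst
  refine continuous_pi fun i => ?_
  rcases i with q | i
  · exact (hA.matrix_transpose.matrix_mul hA).matrix_elem q.1 q.2
  · exact (continuous_apply i).comp continuous_snd

/-! ### Continuous coefficients on the space of invariants -/

section

variable {m n m' : ℕ} {g : Fin 3 → ℝ}
  {f : Matrix (Fin 3) (Fin m) ℝ × (Fin n → ℝ) → Matrix (Fin 3) (Fin m') ℝ}

theorem IsSubequivariant.exists_eq_augment_mul (hf : IsSubequivariant g f)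
    (p : Matrix (Fin 3) (Fin m) ℝ × (Fin n → ℝ)) :
    ∃ S : Matrix (Fin m ⊕ Unit) (Fin m') ℝ, f p = augment g p.1 * S := by
  refine Matrix.exists_mul_eq_of_orthogonalGroup fun O hO => ?_
  obtain ⟨hOg, hZ⟩ := exists_gravityGroup_of_mul_augment_eq hO
  rw [← hf O hOg, hZ]

/-- The orthogonal matrix relating the two points lies in `O_g(3)`, and it passes through both `f`
and `augment`. -/
theorem IsSubequivariant.eq_augment_mul_of_gramInput_eq (hf : IsSubequivariant g f)
    {p q : Matrix (Fin 3) (Fin m) ℝ × (Fin n → ℝ)} (hpq : gramInput g p = gramInput g q)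
    {S : Matrix (Fin m ⊕ Unit) (Fin m') ℝ} (hS : f p = augment g p.1 * S) :
    f q = augment g q.1 * S := by
  obtain ⟨Z, h⟩ := p
  obtain ⟨Z', h'⟩ := q
  have hh : h = h' := funext fun i => congrFun hpq (Sum.inr i)
  have hG : (augment g Z).transpose * augment g Z = (augment g Z').transpose * augment g Z' := by
    ext i j
    exact congrFun hpq (Sum.inl (i, j))
  obtain ⟨O, hO⟩ := Matrix.exists_orthogonalGroup_mul_eq hG
  obtain ⟨hOg, rfl⟩ := exists_gravityGroup_of_mul_augment_eq hO
  subst hh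
  rw [hf O hOg, hS, augment_mul hOg, Matrix.mul_assoc]

/-- On a compact set, a continuous subequivariant function is approximated by `[Z, g] * σ`, where
`σ` is a continuous function of the invariants. -/
theorem IsSubequivariant.exists_continuousMap (hf : IsSubequivariant g f)
    {K : Set (Matrix (Fin 3) (Fin m) ℝ × (Fin n → ℝ))} (hK : IsCompact K) (hfK : ContinuousOn f K)
    {ε : ℝ} (hε : 0 < ε) :
    ∃ σ : C(gramInput g '' K, Matrix (Fin m ⊕ Unit) (Fin m') ℝ), ∀ p (hp : p ∈ K),
      frobeniusNorm (f p - augment g p.1 * σ ⟨gramInput g p, p, hp, rfl⟩) < ε := by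
  -- Coefficients admissible at every point of the fibre over `y`.
  let t : gramInput g '' K → Set (Matrix (Fin m ⊕ Unit) (Fin m') ℝ) := fun y =>
    ⋂ p ∈ {p ∈ K | gramInput g p = y}, {S | frobeniusNorm (f p - augment g p.1 * S) < ε}
  obtain ⟨σ, hσ⟩ := exists_continuous_forall_mem_convex_of_local_const (t := t)
    (fun y => convex_iInter₂ fun p _ => convex_frobeniusNorm_sub_mul_lt _ _ _) (by
      rintro ⟨_, q, hq, rfl⟩
      obtain ⟨S, hS⟩ := hf.exists_eq_augment_mul q
      refine ⟨S, ?_⟩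
      have hcont : ContinuousOn (fun p => frobeniusNorm (f p - augment g p.1 * S)) K :=
        continuous_frobeniusNorm.comp_continuousOn (hfK.sub
          (((continuous_augment g).comp continuous_fst).matrix_mul continuous_const).continuousOn)
      -- The points of `K` where `S` fails form a compact set; its image is closed and misses
      -- `gramInput g q`, so `S` works on all nearby fibres.
      have hB : IsCompact (K ∩ (fun p => frobeniusNorm (f p - augment g p.1 * S)) ⁻¹' Set.Ici ε) :=
        hK.of_isClosed_subset (hcont.preimage_isClosed_of_isClosed hK.isClosed isClosed_Ici)
          Set.inter_subset_left
      have hout : gramInput g q ∈ (gramInput g '' (K ∩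
          (fun p => frobeniusNorm (f p - augment g p.1 * S)) ⁻¹' Set.Ici ε))ᶜ := by
        rintro ⟨p, ⟨-, hp⟩, hpq⟩
        rw [Set.mem_preimage, hf.eq_augment_mul_of_gramInput_eq hpq.symm hS, sub_self,
          frobeniusNorm_zero] at hp
        exact absurd hε (not_lt.2 hp)
      have hopen := (hB.image (continuous_gramInput g)).isClosed.isOpen_compl.mem_nhds hout
      filter_upwards [continuous_subtype_val.continuousAt.preimage_mem_nhds hopen] with y hy
      simp only [t, Set.mem_iInter]
      rintro p ⟨hp, hpy⟩
      change frobeniusNorm (f p - augment g p.1 * S) < ε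
      exact lt_of_not_ge fun hle => hy ⟨p, ⟨hp, hle⟩, hpy⟩)
  refine ⟨σ, fun p hp => ?_⟩
  have := hσ ⟨gramInput g p, p, hp, rfl⟩
  simp only [t, Set.mem_iInter] at this
  exact this p ⟨hp, rfl⟩

/-- The product is jointly continuous and vanishes at `D = 0`; compactness of `K` makes `δ` uniform.
-/
theorem exists_forall_frobeniusNorm_augment_mul_lt (m' : ℕ)
    {K : Set (Matrix (Fin 3) (Fin m) ℝ × (Fin n → ℝ))} (hK : IsCompact K) {ε : ℝ} (hε : 0 < ε) :
    ∃ δ > 0, ∀ D : Matrix (Fin m ⊕ Unit) (Fin m') ℝ, (∀ i j, |D i j| < δ) →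
      ∀ p ∈ K, frobeniusNorm (augment g p.1 * D) < ε := by
  have hcont : Continuous fun z : (Matrix (Fin 3) (Fin m) ℝ × (Fin n → ℝ)) ×
      (Matrix (Fin m ⊕ Unit) (Fin m') ℝ) => frobeniusNorm (augment g z.1.1 * z.2) :=
    continuous_frobeniusNorm.comp
      (((continuous_augment g).comp (continuous_fst.comp continuous_fst)).matrix_mul continuous_snd)
  have hev : ∀ᶠ D : Matrix (Fin m ⊕ Unit) (Fin m') ℝ in 𝓝 0,
      ∀ p ∈ K, frobeniusNorm (augment g p.1 * D) < ε := by
    refine hK.eventually_forall_of_forall_eventually fun p _ => ?_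
    refine (hcont.comp continuous_swap).continuousAt.eventually_lt_const ?_
    simpa [frobeniusNorm_zero] using hε
  have hev' : ∀ᶠ D : (Fin m ⊕ Unit) → Fin m' → ℝ in 𝓝 0,
      ∀ p ∈ K, frobeniusNorm (augment g p.1 * Matrix.of D) < ε := hev
  obtain ⟨δ, hδ, h⟩ := Metric.eventually_nhds_iff.1 hev'
  refine ⟨δ, hδ, fun D hD => h (y := D) ?_⟩
  refine (dist_pi_lt_iff hδ).2 fun i => (dist_pi_lt_iff hδ).2 fun j => ?_
  simpa [Real.dist_eq] using hD i j

end

theorem theorem1 (m n m' : ℕ) (g : Fin 3 → ℝ) :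
    (∀ σ : Matrix (Fin m ⊕ Unit) (Fin m ⊕ Unit) ℝ → (Fin n → ℝ) →
        Matrix (Fin m ⊕ Unit) (Fin m') ℝ,
      IsSubequivariant g (subequivariantMap g σ)) ∧
    (∀ ρ : ℝ → ℝ, Continuous ρ → (¬ ∃ P : Polynomial ℝ, ∀ t : ℝ, ρ t = P.eval t) →
      ∀ f : Matrix (Fin 3) (Fin m) ℝ × (Fin n → ℝ) → Matrix (Fin 3) (Fin m') ℝ,
        IsSubequivariant g f →
        ∀ K : Set (Matrix (Fin 3) (Fin m) ℝ × (Fin n → ℝ)), IsCompact K → ContinuousOn f K →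
          ∀ ε : ℝ, 0 < ε →
            ∃ N : MLP ((Fin m ⊕ Unit) × Fin m') (((Fin m ⊕ Unit) × (Fin m ⊕ Unit)) ⊕ Fin n),
              ∀ p ∈ K,
                frobeniusNorm (f p - subequivariantMap g (N.matrixMap ρ) p) < ε) := by
  refine ⟨isSubequivariant_subequivariantMap g, ?_⟩
  intro ρ hc hρ f hf K hK hfK ε hε
  obtain ⟨σ, hσ⟩ := hf.exists_continuousMap hK hfK (half_pos hε)
  obtain ⟨δ, hδ, hD⟩ := exists_forall_frobeniusNorm_augment_mul_lt (g := g) m' hK (half_pos hε)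
  let σ' : C(gramInput g '' K, (Fin m ⊕ Unit) × Fin m' → ℝ) :=
    ⟨fun y q => σ y q.1 q.2, continuous_pi fun q => σ.continuous.matrix_elem q.1 q.2⟩
  obtain ⟨N, hN⟩ := MLP.exists_forall_abs_sub_lt ρ hc hρ (hK.image (continuous_gramInput g)) σ' hδ
  refine ⟨N, fun p hp => ?_⟩
  let s := σ ⟨gramInput g p, p, hp, rfl⟩
  let T := N.matrixMap ρ ((augment g p.1).transpose * augment g p.1) p.2
  -- The first term is the error of `σ`, the second that of the perceptron; each is below `ε / 2`.
  have hsplit : f p - subequivariantMap g (N.matrixMap ρ) p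
      = (f p - augment g p.1 * s) + augment g p.1 * (s - T) := by
    rw [Matrix.mul_sub, sub_add_sub_cancel]
    rfl
  rw [hsplit, ← add_halves ε]
  exact (frobeniusNorm_add_le _ _).trans_lt (add_lt_add (hσ p hp)
    (hD _ (fun i j => hN ⟨gramInput g p, p, hp, rfl⟩ (i, j)) p hp))
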